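/- Let $n\ge 1$ and let $\Omega\subset\mathbb{R}^n$ be a non-empty bounded convex domain with smooth boundary and outer unit normal $\nu$. Let $p^*$ satisfy $\frac1{p^*}=\frac12-\frac1n$ if $n\ge 3$, and let $2\le p^*<\infty$ be arbitrary if $n=1,2$. Let $0<c_1$, $0<c_2$ be constants. Then there is a constant $C>0$, depending only on $n$, $\Omega$, $p^*$, $c_1$ and $c_2$, with the following property. Let $\alpha>1$, let $d,\phi,\rho_0$ be $C^2$ functions on $\overline\Omega$ such that $d\ge D$ on $\overline\Omega$ for some constant $D>0$, $\rho_0>0$ on $\overline\Omega$ and $\int_\Omega\rho_0\,dx=1$. Let $\rho$ be a positive classical solution on $\overline\Omega\times[0,\infty)$ of $$\begin{cases}\dfrac{\partial\rho}{\partial t}-\operatorname{div}\bigl(\rho\nabla(\alpha d(x)\rho^{\alpha-1}+\phi(x))\bigr)=0, & x\in\Omega,\ t>0,\\ \rho(x,0)=\rho_0(x), & x\in\Omega,\\ \rho\nabla(\alpha d(x)\rho^{\alpha-1}+\phi(x))\cdot\nu=0, & x\in\partial\Omega,\ t>0,\end{cases}$$ that is, $\rho>0$ is continuous on $\overline\Omega\times[0,\infty)$,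 of class $C^2$ in $x$ on $\overline\Omega$ for every $t\ge0$, differentiable in $t$ at every $x\in\Omega$, $t>0$, and satisfies the above pointwise. Suppose that $c_1\le\rho(x,t)\le c_2$ for all $x\in\overline\Omega$, $t>0$. Then for every $t\ge 0$ and every vector field $v\in C^1(\Omega;\mathbb{R}^n)$, $$\left(\int_\Omega|v-\overline v|^{p^*}\rho(x,t)\,dx\right)^{1/p^*}\le C\left(\int_\Omega|\nabla v|^2\rho(x,t)\,dx\right)^{1/2},$$ where $\overline v=\frac1{|\Omega|}\int_\Omega v\,dx$ and $|\nabla v|^2=\sum_{i,j}(\partial_i v_j)^2$. Here, if the integral on the right-hand side is finite, then $v$ is integrable on $\Omega$ (so that $\overline v$ is defined) and the inequality holds; if it is infinite, the inequality is understood to be trivial. -/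

import Mathlib

open MeasureTheory Set Filter Topology
open scoped ContDiff

noncomputable section

namespace NFP

/-- `g` is a smooth function describing `Ω` near the boundary point `x`: near `x` the set `Ω` is
`{g < 0}`, and `g` vanishes at `x` with non-zero gradient there. -/
structure IsDefiningFunctionAt {n : ℕ} (Ω : Set (EuclideanSpace ℝ (Fin n)))
    (x : EuclideanSpace ℝ (Fin n)) (g : EuclideanSpace ℝ (Fin n) → ℝ) : Prop where
  contDiff : ContDiff ℝ ∞ g
  eq_zero : g x = 0
  gradient_ne_zero : gradient g x ≠ 0
  mem_iff : ∀ᶠ y in 𝓝 x, (y ∈ Ω ↔ g y < 0)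

/-- A bounded convex domain of `ℝⁿ` with smooth boundary. -/
structure IsSmoothConvexDomain {n : ℕ} (Ω : Set (EuclideanSpace ℝ (Fin n))) : Prop where
  isOpen : IsOpen Ω
  nonempty : Ω.Nonempty
  isBounded : Bornology.IsBounded Ω
  convex : Convex ℝ Ω
  smooth_boundary : ∀ x ∈ frontier Ω, ∃ g, IsDefiningFunctionAt Ω x g

/-- `ν` is the outer unit normal vector of `∂Ω` at `x`. -/
def IsOuterUnitNormal {n : ℕ} (Ω : Set (EuclideanSpace ℝ (Fin n)))
    (x ν : EuclideanSpace ℝ (Fin n)) : Prop :=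
  ∃ g, IsDefiningFunctionAt Ω x g ∧ ν = ‖gradient g x‖⁻¹ • gradient g x

/-- The divergence `∑ᵢ ∂ᵢFᵢ` of a vector field. -/
def divergence {n : ℕ} (F : EuclideanSpace ℝ (Fin n) → EuclideanSpace ℝ (Fin n))
    (x : EuclideanSpace ℝ (Fin n)) : ℝ :=
  ∑ i, (fderiv ℝ F x (EuclideanSpace.single i 1)) i

/-- `|∇v|² = ∑ᵢⱼ (∂ᵢvⱼ)²`, the squared Frobenius norm of the Jacobian matrix of `v`. -/
def gradNormSq {n : ℕ} (v : EuclideanSpace ℝ (Fin n) → EuclideanSpace ℝ (Fin n))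
    (x : EuclideanSpace ℝ (Fin n)) : ℝ :=
  ∑ i, ∑ j, ((fderiv ℝ v x (EuclideanSpace.single i 1)) j) ^ 2

/-- The potential `μ = α d(x) ρ^(α-1) + φ(x)` of a density `u` on the space. -/
def potential {n : ℕ} (α : ℝ) (d φ u : EuclideanSpace ℝ (Fin n) → ℝ)
    (x : EuclideanSpace ℝ (Fin n)) : ℝ :=
  α * d x * u x ^ (α - 1) + φ x

/-- The vector field `ρ ∇(α d(x) ρ^(α-1) + φ(x))` on the closure of `Ω`, for a density `u`; on the
boundary the gradient is the one-sided one, and at points of the open set `Ω` it is the usual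
gradient. -/
def flux {n : ℕ} (Ω : Set (EuclideanSpace ℝ (Fin n))) (α : ℝ)
    (d φ u : EuclideanSpace ℝ (Fin n) → ℝ) (x : EuclideanSpace ℝ (Fin n)) :
    EuclideanSpace ℝ (Fin n) :=
  u x • gradientWithin (potential α d φ u) (closure Ω) x

/-- The assumptions on the exponent, the coefficients and the initial value of the nonlinear
Fokker-Planck problem. -/
structure IsData {n : ℕ} (Ω : Set (EuclideanSpace ℝ (Fin n))) (α : ℝ)
    (d φ ρ₀ : EuclideanSpace ℝ (Fin n) → ℝ) : Prop where
  one_lt : 1 < α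
  contDiffOn_d : ContDiffOn ℝ 2 d (closure Ω)
  contDiffOn_φ : ContDiffOn ℝ 2 φ (closure Ω)
  contDiffOn_ρ₀ : ContDiffOn ℝ 2 ρ₀ (closure Ω)
  d_bound : ∃ D > 0, ∀ x ∈ closure Ω, D ≤ d x
  ρ₀_pos : ∀ x ∈ closure Ω, 0 < ρ₀ x
  integral_ρ₀ : ∫ x in Ω, ρ₀ x = 1

/-- `ρ` (written `ρ x t`) is a positive classical solution on `closure Ω × [0, ∞)` of
`∂ₜρ - div (ρ ∇(α d ρ^(α-1) + φ)) = 0` in `Ω`, `t > 0`, with initial value `ρ₀` and the no-flux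
boundary condition. -/
structure IsClassicalSolution {n : ℕ} (Ω : Set (EuclideanSpace ℝ (Fin n))) (α : ℝ)
    (d φ ρ₀ : EuclideanSpace ℝ (Fin n) → ℝ) (ρ : EuclideanSpace ℝ (Fin n) → ℝ → ℝ) : Prop where
  pos : ∀ x ∈ closure Ω, ∀ t, 0 ≤ t → 0 < ρ x t
  continuousOn : ContinuousOn (fun z : EuclideanSpace ℝ (Fin n) × ℝ => ρ z.1 z.2)
    (closure Ω ×ˢ Ici 0)
  contDiffOn : ∀ t, 0 ≤ t → ContDiffOn ℝ 2 (fun x => ρ x t) (closure Ω)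
  equation : ∀ x ∈ Ω, ∀ t, 0 < t →
    HasDerivAt (fun s => ρ x s) (divergence (flux Ω α d φ (fun y => ρ y t)) x) t
  initial : ∀ x ∈ Ω, ρ x 0 = ρ₀ x
  boundary : ∀ x ∈ frontier Ω, ∀ t, 0 < t → ∀ ν, IsOuterUnitNormal Ω x ν →
    inner ℝ (flux Ω α d φ (fun y => ρ y t) x) ν = 0

/-- The admissible exponents `p*` in dimension `n`: the Sobolev exponent `1/p* = 1/2 - 1/n` if
`n ≥ 3`, and any finite `p* ≥ 2` if `n = 1, 2`. -/
def IsSobolevExponent (n : ℕ) (p : ℝ) : Prop :=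
  (3 ≤ n ∧ 1 / p = 1 / 2 - 1 / (n : ℝ)) ∨ ((n = 1 ∨ n = 2) ∧ 2 ≤ p)

end NFP

end

/-!
The bounds `c₁ ≤ ρ ≤ c₂` hold for all `t ≥ 0` by continuity (`NFP.IsClassicalSolution.bounds`), and
they reduce the claim to the Sobolev-Poincaré inequality `‖v - v̄‖_p ≤ C ‖∇v‖₂` without weight on a
bounded convex open set `Ω` (`NFP.exists_lintegral_enorm_sub_setAverage_rpow_le`).

A radial map built from the gauges of the two sets is a bi-Lipschitz homeomorphism between the unit
cube and `Ω` (`NFP.exists_biLipschitz_cube`). Composition with it does not preserve `C¹` functions,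
so the argument on the cube is carried out for functions `u` whose pointwise Lipschitz constant is
at most a continuous function `g` (`NFP.HasLipBoundAt`). This notion is stable under Lipschitz maps,
powers and truncation, and `|u b - u a| ≤ ∫ g` along segments.

On the cube, `u` is bounded at each point by the integral of `u + g` over each of the coordinate
lines through the point; the grid-lines lemma of Mathlib turns this into
`‖u‖_{n/(n-1)} ≤ ‖u + g‖₁` (`NFP.lintegral_cube_rpow_le`). For `u ^ γ` with `γ = p (n - 1) / n`,
the inequalities of Cauchy-Schwarz and Jensen give `‖u‖_p ^ γ ≤ ‖u‖_p ^ (γ - 1) ‖u + γ g‖₂`, and if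
`u` is bounded one may divide. Truncation removes the boundedness
(`NFP.exists_lintegral_cube_rpow_le`). In dimension one, `u` is bounded by the integral of `u + g`.

It remains to bound `‖v - v̄‖₂` by `‖∇v‖₂`, which is done on `Ω` itself: `v y - v x` is an integral
of the derivative over a segment in `Ω`, and the substitution `y ↦ (1 - s) x + s y` has a Jacobian
bounded below for `s ≥ 1/2`, the case `s ≤ 1/2` being symmetric
(`NFP.lintegral_lintegral_enorm_sub_sq_le`).
-/

namespace NFP

/-! ### Pointwise Lipschitz constants -/

/-- The pointwise Lipschitz constant of `f` at `x` is at most `K`: near `x`, the function `f` moves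
points away from `f x` by a factor of at most `r`, for every `r > K`. -/
def HasLipBoundAt {X Y : Type*} [PseudoMetricSpace X] [PseudoMetricSpace Y] (f : X → Y) (x : X)
    (K : ℝ) : Prop :=
  ∀ r > K, ∀ᶠ y in 𝓝 x, dist (f y) (f x) ≤ r * dist y x

section

variable {X Y Z : Type*} [PseudoMetricSpace X] [PseudoMetricSpace Y] [PseudoMetricSpace Z]

theorem HasLipBoundAt.mono {f : X → Y} {x : X} {K L : ℝ} (hf : HasLipBoundAt f x K) (h : K ≤ L) :
    HasLipBoundAt f x L :=
  fun r hr => hf r (h.trans_lt hr)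

theorem HasLipBoundAt.continuousAt {f : X → Y} {x : X} {K : ℝ} (hf : HasLipBoundAt f x K) :
    ContinuousAt f x := by
  rw [ContinuousAt, tendsto_iff_dist_tendsto_zero]
  have h : Tendsto (fun y => (K + 1) * dist y x) (𝓝 x) (𝓝 0) := by
    have : Tendsto (fun y => (K + 1) * dist y x) (𝓝 x) (𝓝 ((K + 1) * dist x x)) :=
      Continuous.tendsto (by fun_prop) x
    simpa using this
  exact squeeze_zero' (Eventually.of_forall fun _ => dist_nonneg) (hf (K + 1) (by linarith)) h

theorem continuousOn_of_hasLipBoundAt {f : X → Y} {K : X → ℝ} {s : Set X}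
    (h : ∀ x ∈ s, HasLipBoundAt f x (K x)) :
    ContinuousOn f s :=
  fun x hx => (h x hx).continuousAt.continuousWithinAt

theorem HasLipBoundAt.comp {φ : Y → Z} {f : X → Y} {x : X} {K L : ℝ}
    (hφ : HasLipBoundAt φ (f x) K) (hf : HasLipBoundAt f x L) (hK : 0 ≤ K) :
    HasLipBoundAt (φ ∘ f) x (K * L) := by
  intro r hr
  -- enlarge `K` and `L` by `ε` so little that the product stays below `r`
  have hlim : Tendsto (fun ε : ℝ => (K + ε) * (L + ε)) (𝓝[>] 0) (𝓝 (K * L)) := by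
    have : Tendsto (fun ε : ℝ => (K + ε) * (L + ε)) (𝓝 0) (𝓝 ((K + 0) * (L + 0))) :=
      Continuous.tendsto (by fun_prop) 0
    simpa using this.mono_left nhdsWithin_le_nhds
  obtain ⟨ε, hε, hε0⟩ := ((hlim.eventually (gt_mem_nhds hr)).and self_mem_nhdsWithin).exists
  have hε0 : 0 < ε := hε0
  filter_upwards [hf (L + ε) (by linarith),
    hf.continuousAt.eventually (hφ (K + ε) (by linarith))] with y h1 h2
  calc dist (φ (f y)) (φ (f x)) ≤ (K + ε) * dist (f y) (f x) := h2
    _ ≤ (K + ε) * ((L + ε) * dist y x) := by gcongr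
    _ = ((K + ε) * (L + ε)) * dist y x := by ring
    _ ≤ r * dist y x := by gcongr

theorem _root_.LipschitzWith.hasLipBoundAt {K : NNReal} {f : X → Y} (hf : LipschitzWith K f)
    (x : X) : HasLipBoundAt f x K := by
  intro r hr
  refine Eventually.of_forall fun y => (hf.dist_le_mul y x).trans ?_
  gcongr

end

theorem _root_.HasFDerivAt.hasLipBoundAt {E F : Type*} [NormedAddCommGroup E] [NormedSpace ℝ E]
    [NormedAddCommGroup F] [NormedSpace ℝ F] {f : E → F} {f' : E →L[ℝ] F} {x : E}
    (hf : HasFDerivAt f f' x) : HasLipBoundAt f x ‖f'‖ := by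
  intro r hr
  filter_upwards [hf.isLittleO.def (sub_pos.2 hr)] with y hy
  rw [dist_eq_norm, dist_eq_norm]
  calc ‖f y - f x‖ = ‖(f y - f x - f' (y - x)) + f' (y - x)‖ := by congr 1; abel
    _ ≤ ‖f y - f x - f' (y - x)‖ + ‖f' (y - x)‖ := norm_add_le _ _
    _ ≤ (r - ‖f'‖) * ‖y - x‖ + ‖f'‖ * ‖y - x‖ := add_le_add hy (f'.le_opNorm _)
    _ = r * ‖y - x‖ := by ring

theorem hasLipBoundAt_rpow {γ : ℝ} (hγ : 1 ≤ γ) {t : ℝ} (ht : 0 ≤ t) :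
    HasLipBoundAt (fun s : ℝ => s ^ γ) t (γ * t ^ (γ - 1)) := by
  have h := (Real.hasDerivAt_rpow_const (x := t) (p := γ) (Or.inr hγ)).hasFDerivAt.hasLipBoundAt
  refine h.mono (le_of_eq ?_)
  rw [ContinuousLinearMap.norm_toSpanSingleton, Real.norm_of_nonneg]
  positivity

/-- The increment of a function of one variable is at most the integral of its pointwise Lipschitz
constant. -/
theorem norm_sub_le_integral_of_hasLipBoundAt {F : Type*} [NormedAddCommGroup F]
    {f : ℝ → F} {g : ℝ → ℝ} {a b : ℝ} (hab : a ≤ b)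
    (hf : ∀ x ∈ Icc a b, HasLipBoundAt f x (g x)) (hg : ContinuousOn g (Icc a b)) :
    ‖f b - f a‖ ≤ ∫ x in a..b, g x := by
  have hfc : ContinuousOn f (Icc a b) := fun x hx => (hf x hx).continuousAt.continuousWithinAt
  have hint : IntervalIntegrable g volume a b := hg.intervalIntegrable_of_Icc hab
  have key := image_le_of_liminf_slope_right_le_deriv_boundary (a := a) (b := b)
    (f := fun x => ‖f x - f a‖) (B := fun x => ∫ s in a..x, g s) (B' := g)
    (by fun_prop) (by simp)
    (by
      have := intervalIntegral.continuousOn_primitive_interval' hint left_mem_uIcc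
      rwa [uIcc_of_le hab] at this)
    (by
      intro x hx
      have hx' : x ∈ Icc a b := Ico_subset_Icc_self hx
      have hmem : Icc a b ∈ 𝓝[>] x := mem_of_superset (Ioo_mem_nhdsGT hx.2)
        (Ioo_subset_Icc_self.trans (Icc_subset_Icc_left hx.1))
      refine intervalIntegral.integral_hasDerivWithinAt_right
        (hint.mono_set (by rw [uIcc_of_le hx.1, uIcc_of_le hab]; exact Icc_subset_Icc_right hx.2.le))
        (t := Ioi x) ⟨Icc a b, hmem, hg.aestronglyMeasurable measurableSet_Icc⟩
        ((hg x hx').mono_of_mem_nhdsWithin hmem))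
    (by
      intro x hx r hr
      refine Eventually.frequently ?_
      obtain ⟨r', hr', hr'r⟩ := exists_between hr
      filter_upwards [nhdsWithin_le_nhds (hf x (Ico_subset_Icc_self hx) r' hr'),
        self_mem_nhdsWithin] with z hz hxz
      have hxz : x < z := hxz
      refine lt_of_le_of_lt ?_ hr'r
      rw [slope_def_field, div_le_iff₀ (sub_pos.2 hxz)]
      rw [dist_eq_norm, Real.dist_eq, abs_of_pos (sub_pos.2 hxz)] at hz
      calc ‖f z - f a‖ - ‖f x - f a‖ ≤ ‖(f z - f a) - (f x - f a)‖ := norm_sub_norm_le _ _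
        _ = ‖f z - f x‖ := by congr 1; abel
        _ ≤ _ := hz)
  exact key (right_mem_Icc.2 hab)

theorem ofReal_norm_sub_le_lintegral_of_hasLipBoundAt {F : Type*} [NormedAddCommGroup F]
    {f : ℝ → F} {g : ℝ → ℝ} {a b : ℝ} (hab : a ≤ b)
    (hf : ∀ x ∈ Icc a b, HasLipBoundAt f x (g x)) (hg : ContinuousOn g (Icc a b))
    (hg0 : ∀ x ∈ Icc a b, 0 ≤ g x) :
    ENNReal.ofReal ‖f b - f a‖ ≤ ∫⁻ x in Icc a b, ENNReal.ofReal (g x) := by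
  refine (ENNReal.ofReal_le_ofReal (norm_sub_le_integral_of_hasLipBoundAt hab hf hg)).trans ?_
  rw [intervalIntegral.integral_of_le hab, ← integral_Icc_eq_integral_Ioc,
    ofReal_integral_eq_lintegral_ofReal (hg.integrableOn_compact isCompact_Icc)]
  exact (ae_restrict_iff' measurableSet_Icc).2 (Eventually.of_forall hg0)

/-! ### The Sobolev inequality on a cube -/

section Cube

variable {ι : Type*} [Fintype ι]

variable (ι) in
/-- The open cube `(-1/2, 1/2)^ι` of volume one: a ball for the sup norm of `ι → ℝ`. -/
def cube : Set (ι → ℝ) := Metric.ball 0 (1 / 2)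

theorem measurableSet_cube : MeasurableSet (cube ι) := measurableSet_ball

theorem isOpen_cube : IsOpen (cube ι) := Metric.isOpen_ball

theorem mem_cube {x : ι → ℝ} : x ∈ cube ι ↔ ∀ i, x i ∈ Ioo (-(1 / 2) : ℝ) (1 / 2) := by
  rw [cube, mem_ball_zero_iff, pi_norm_lt_iff (by norm_num)]
  simp only [Real.norm_eq_abs, abs_lt, mem_Ioo]

theorem volume_cube : volume (cube ι) = 1 := by
  rw [cube, Real.volume_pi_ball _ (by norm_num)]
  norm_num

instance : IsProbabilityMeasure (volume.restrict (cube ι)) :=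
  ⟨by rw [Measure.restrict_apply_univ, volume_cube]⟩

theorem lipschitzWith_update [DecidableEq ι] (x : ι → ℝ) (i : ι) :
    LipschitzWith 1 (Function.update x i) := by
  refine LipschitzWith.of_dist_le_mul fun s t => ?_
  rw [NNReal.coe_one, one_mul, dist_pi_le_iff dist_nonneg]
  intro j
  by_cases h : j = i
  · subst h; simp
  · simp [h]

theorem update_mem_cube_iff [DecidableEq ι] {x : ι → ℝ} (hx : x ∈ cube ι) (i : ι) (s : ℝ) :
    Function.update x i s ∈ cube ι ↔ s ∈ Ioo (-(1 / 2) : ℝ) (1 / 2) := by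
  rw [mem_cube] at *
  refine ⟨fun h => by simpa using h i, fun h j => ?_⟩
  by_cases hj : j = i
  · subst hj; simpa using h
  · simpa [hj] using hx j

variable {u g : (ι → ℝ) → ℝ}

/-- A function on the cube is bounded by the integral of itself and its pointwise Lipschitz
constant over any coordinate line. -/
theorem ofReal_le_lintegral_update [DecidableEq ι]
    (hu : ∀ y ∈ cube ι, HasLipBoundAt u y (g y)) (hg : ContinuousOn g (cube ι))
    (hu0 : ∀ y ∈ cube ι, 0 ≤ u y) (hg0 : ∀ y ∈ cube ι, 0 ≤ g y) {x : ι → ℝ} (hx : x ∈ cube ι)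
    (i : ι) :
    ENNReal.ofReal (u x) ≤
      ∫⁻ s, (cube ι).indicator (fun y => ENNReal.ofReal (u y + g y)) (Function.update x i s) := by
  set J : Set ℝ := Ioo (-(1 / 2) : ℝ) (1 / 2) with hJ
  have hJm : MeasurableSet J := measurableSet_Ioo
  have hmem : ∀ s ∈ J, Function.update x i s ∈ cube ι := fun s hs =>
    (update_mem_cube_iff hx i s).2 hs
  have hxJ : x i ∈ J := mem_cube.1 hx i
  have hcont : Continuous (Function.update x i) := (lipschitzWith_update x i).continuous
  have huc : ContinuousOn (fun s => u (Function.update x i s)) J :=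
    (continuousOn_of_hasLipBoundAt hu).comp hcont.continuousOn hmem
  have hgc : ContinuousOn (fun s => g (Function.update x i s)) J :=
    hg.comp hcont.continuousOn hmem
  have hlip : ∀ s ∈ J, HasLipBoundAt (fun s => u (Function.update x i s)) s
      (g (Function.update x i s)) := by
    intro s hs
    have := (hu _ (hmem s hs)).comp ((lipschitzWith_update x i).hasLipBoundAt s)
      (hg0 _ (hmem s hs))
    simpa [Function.comp_def] using this
  set I : ENNReal := ∫⁻ s in J, ENNReal.ofReal (g (Function.update x i s)) with hI
  have hseg : ∀ a b, a ∈ J → b ∈ J → a ≤ b →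
      ENNReal.ofReal ‖u (Function.update x i b) - u (Function.update x i a)‖ ≤ I := by
    intro a b ha hb hab
    have hsub : Icc a b ⊆ J := fun s hs => ⟨ha.1.trans_le hs.1, hs.2.trans_lt hb.2⟩
    exact (ofReal_norm_sub_le_lintegral_of_hasLipBoundAt hab (fun s hs => hlip s (hsub hs))
      (hgc.mono hsub) (fun s hs => hg0 _ (hmem s (hsub hs)))).trans (lintegral_mono_set hsub)
  -- compare `u x` with the value at `t`, to be averaged over `t ∈ J`
  have hpt : ∀ t ∈ J, ENNReal.ofReal (u x) ≤ ENNReal.ofReal (u (Function.update x i t)) + I := by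
    intro t ht
    have h1 : ENNReal.ofReal ‖u x - u (Function.update x i t)‖ ≤ I := by
      rcases le_total t (x i) with h | h
      · simpa using hseg t (x i) ht hxJ h
      · have := hseg (x i) t hxJ ht h
        rw [norm_sub_rev] at this
        simpa using this
    calc ENNReal.ofReal (u x)
        ≤ ENNReal.ofReal (u (Function.update x i t) + ‖u x - u (Function.update x i t)‖) := by
          refine ENNReal.ofReal_le_ofReal ?_
          have := Real.le_norm_self (u x - u (Function.update x i t))
          linarith
      _ ≤ _ := ENNReal.ofReal_add_le.trans (by gcongr)
  have hvol : volume J = 1 := by rw [hJ, Real.volume_Ioo]; norm_num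
  calc ENNReal.ofReal (u x) = ∫⁻ _ in J, ENNReal.ofReal (u x) := by simp [hvol]
    _ ≤ ∫⁻ t in J, (ENNReal.ofReal (u (Function.update x i t)) + I) := setLIntegral_mono' hJm hpt
    _ = (∫⁻ t in J, ENNReal.ofReal (u (Function.update x i t))) + I := by
        rw [lintegral_add_right _ measurable_const]; simp [hvol]
    _ = ∫⁻ t in J, ENNReal.ofReal (u (Function.update x i t) + g (Function.update x i t)) := by
        rw [hI, ← lintegral_add_left' (huc.aemeasurable hJm).ennreal_ofReal]
        refine setLIntegral_congr_fun hJm fun t ht => ?_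
        exact (ENNReal.ofReal_add (hu0 _ (hmem t ht)) (hg0 _ (hmem t ht))).symm
    _ = _ := by
        rw [← lintegral_indicator hJm]
        refine lintegral_congr fun s => ?_
        simp only [indicator, update_mem_cube_iff hx i s, ← hJ]

/-- The Gagliardo-Nirenberg inequality `W^{1,1} ⊂ L^{n/(n-1)}` on the cube. -/
theorem lintegral_cube_rpow_le
    (hu : ∀ y ∈ cube ι, HasLipBoundAt u y (g y)) (hg : ContinuousOn g (cube ι))
    (hu0 : ∀ y ∈ cube ι, 0 ≤ u y) (hg0 : ∀ y ∈ cube ι, 0 ≤ g y) {q : ℝ}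
    (hq : Real.HolderConjugate (Fintype.card ι) q) :
    ∫⁻ x in cube ι, ENNReal.ofReal (u x) ^ q ≤
      (∫⁻ x in cube ι, ENNReal.ofReal (u x + g x)) ^ q := by
  classical
  have hmeas : Measurable ((cube ι).indicator (fun y => ENNReal.ofReal (u y + g y))) := by
    rw [← piecewise_eq_indicator]
    exact ContinuousOn.measurable_piecewise (ENNReal.continuous_ofReal.comp_continuousOn
      ((continuousOn_of_hasLipBoundAt hu).add hg)) continuousOn_const measurableSet_cube
  have key := lintegral_prod_lintegral_pow_le (μ := fun _ : ι => (volume : Measure ℝ)) hq hmeas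
  rw [← volume_pi, lintegral_indicator measurableSet_cube] at key
  refine le_trans ?_ key
  rw [← lintegral_indicator measurableSet_cube]
  refine lintegral_mono fun x => ?_
  by_cases hx : x ∈ cube ι
  swap
  · rw [indicator_of_notMem hx]; exact zero_le
  rw [indicator_of_mem hx]
  calc ENNReal.ofReal (u x) ^ q
      = ∏ _i : ι, ENNReal.ofReal (u x) ^ ((1 : ℝ) / (Fintype.card ι - 1 : ℝ)) := by
        rw [Finset.prod_const, ← ENNReal.rpow_natCast, ← ENNReal.rpow_mul, Finset.card_univ,
          hq.conjugate_eq]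
        congr 1
        ring
    _ ≤ _ := by
        have hcard : (1 : ℝ) < Fintype.card ι := hq.lt
        exact Finset.prod_le_prod' fun i _ => ENNReal.rpow_le_rpow
          (ofReal_le_lintegral_update hu hg hu0 hg0 hx i) (div_nonneg zero_le_one (by linarith))

/-- In dimension one, the only coordinate line is the cube itself. -/
theorem ofReal_le_lintegral_cube_of_unique [Unique ι]
    (hu : ∀ y ∈ cube ι, HasLipBoundAt u y (g y)) (hg : ContinuousOn g (cube ι))
    (hu0 : ∀ y ∈ cube ι, 0 ≤ u y) (hg0 : ∀ y ∈ cube ι, 0 ≤ g y) {x : ι → ℝ} (hx : x ∈ cube ι) :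
    ENNReal.ofReal (u x) ≤ ∫⁻ y in cube ι, ENNReal.ofReal (u y + g y) := by
  classical
  obtain rfl : ‹Fintype ι› = Unique.fintype := Subsingleton.elim _ _
  refine (ofReal_le_lintegral_update hu hg hu0 hg0 hx default).trans (le_of_eq ?_)
  rw [← lintegral_indicator measurableSet_cube]
  refine Eq.trans ?_ (((volume_preserving_funUnique ι ℝ).symm).lintegral_comp_emb
    (MeasurableEquiv.measurableEmbedding _) _)
  refine lintegral_congr fun s => ?_
  congr 1
  ext j
  rw [Subsingleton.elim j default]
  simp

/-- Absorption: a smaller power of `A` on the right is divided out, which needs `A` to be finite. -/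
theorem _root_.ENNReal.le_rpow_of_le_rpow_mul_rpow {A S : ENNReal} (hA : A ≠ ⊤) {γ r : ℝ}
    (hγ : 1 ≤ γ) (h : A ≤ A ^ ((γ - 1) / γ) * S ^ (r / γ)) : A ≤ S ^ r := by
  rcases eq_or_ne A 0 with h0 | h0
  · rw [h0]; exact zero_le
  have hγ0 : 0 < γ := by linarith
  have h1 : A ^ (1 / γ) ≤ S ^ (r / γ) := by
    have hne : A ^ ((γ - 1) / γ) ≠ 0 := by simp [h0, hA]
    have hnt : A ^ ((γ - 1) / γ) ≠ ⊤ := by simp [h0, hA]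
    rw [← ENNReal.mul_le_mul_iff_right hne hnt, ← ENNReal.rpow_add _ _ h0 hA]
    have : (γ - 1) / γ + 1 / γ = 1 := by field_simp; ring
    rwa [this, ENNReal.rpow_one]
  have h2 := ENNReal.rpow_le_rpow h1 hγ0.le
  rwa [← ENNReal.rpow_mul, ← ENNReal.rpow_mul, div_mul_cancel₀ _ hγ0.ne',
    div_mul_cancel₀ _ hγ0.ne', ENNReal.rpow_one] at h2

/-- Jensen's inequality for powers, including the exponent zero. -/
theorem _root_.MeasureTheory.lintegral_rpow_le_rpow_lintegral {α : Type*} [MeasurableSpace α]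
    {μ : Measure α} [IsProbabilityMeasure μ] {f : α → ENNReal} (hf : AEMeasurable f μ)
    {a b : ℝ} (ha : 0 ≤ a) (hab : a ≤ b) :
    ∫⁻ x, f x ^ a ∂μ ≤ (∫⁻ x, f x ^ b ∂μ) ^ (a / b) := by
  rcases ha.eq_or_lt with rfl | ha
  · simp
  have h := eLpNorm'_le_eLpNorm'_of_exponent_le ha hab μ hf.aestronglyMeasurable
  have h2 := ENNReal.rpow_le_rpow h ha.le
  simp only [eLpNorm'_eq_lintegral_enorm, enorm_eq_self] at h2
  rwa [← ENNReal.rpow_mul, ← ENNReal.rpow_mul, one_div_mul_cancel ha.ne', ENNReal.rpow_one,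
    one_div_mul_eq_div] at h2

theorem _root_.MeasureTheory.lintegral_mul_le_sqrt {α : Type*} [MeasurableSpace α]
    {μ : Measure α} {f h : α → ENNReal} (hf : AEMeasurable f μ) (hh : AEMeasurable h μ) :
    ∫⁻ x, f x * h x ∂μ ≤
      (∫⁻ x, f x ^ (2 : ℝ) ∂μ) ^ (1 / 2 : ℝ) * (∫⁻ x, h x ^ (2 : ℝ) ∂μ) ^ (1 / 2 : ℝ) :=
  ENNReal.lintegral_mul_le_Lp_mul_Lq μ Real.HolderConjugate.two_two hf hh

/-- The Sobolev inequality on the cube for bounded functions: the Gagliardo-Nirenberg inequality for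
the power `u ^ γ`. Boundedness allows to divide by a power of the norm on the left. -/
theorem lintegral_cube_rpow_le_of_bounded
    (hu : ∀ y ∈ cube ι, HasLipBoundAt u y (g y)) (hg : ContinuousOn g (cube ι))
    (hu0 : ∀ y ∈ cube ι, 0 ≤ u y) (hg0 : ∀ y ∈ cube ι, 0 ≤ g y)
    {M : ℝ} (hM : ∀ y ∈ cube ι, u y ≤ M) {q γ p : ℝ}
    (hq : Real.HolderConjugate (Fintype.card ι) q) (hγ : 1 ≤ γ) (hγq : γ * q = p)
    (hγp : 2 * (γ - 1) ≤ p) :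
    ∫⁻ x in cube ι, ENNReal.ofReal (u x) ^ p ≤
      (∫⁻ x in cube ι, ENNReal.ofReal (u x + γ * g x) ^ (2 : ℝ)) ^ (p / 2) := by
  have hq0 : 0 < q := hq.symm.pos
  have hp0 : 0 < p := hγq ▸ mul_pos (by linarith) hq0
  have huc : ContinuousOn u (cube ι) := continuousOn_of_hasLipBoundAt hu
  have hum : AEMeasurable (fun x => ENNReal.ofReal (u x)) (volume.restrict (cube ι)) :=
    (huc.aemeasurable measurableSet_cube).ennreal_ofReal
  have hgm : AEMeasurable (fun x => ENNReal.ofReal (u x + γ * g x)) (volume.restrict (cube ι)) :=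
    ((huc.add (hg.const_mul γ)).aemeasurable measurableSet_cube).ennreal_ofReal
  set A := ∫⁻ x in cube ι, ENNReal.ofReal (u x) ^ p with hA
  set S := ∫⁻ x in cube ι, ENNReal.ofReal (u x + γ * g x) ^ (2 : ℝ) with hS
  have hAtop : A ≠ ⊤ := by
    refine ne_top_of_le_ne_top (b := ENNReal.ofReal M ^ p) (by simp [hp0.le]) ?_
    calc A ≤ ∫⁻ _ in cube ι, ENNReal.ofReal M ^ p :=
          setLIntegral_mono' measurableSet_cube fun x hx =>
            ENNReal.rpow_le_rpow (ENNReal.ofReal_le_ofReal (hM x hx)) hp0.le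
      _ = _ := by simp
  have h1 := lintegral_cube_rpow_le (u := fun x => u x ^ γ)
    (g := fun x => γ * u x ^ (γ - 1) * g x)
    (fun y hy => (hasLipBoundAt_rpow hγ (hu0 y hy)).comp (hu y hy)
      (mul_nonneg (by linarith) (Real.rpow_nonneg (hu0 y hy) _)))
    (((huc.rpow_const fun x _ => Or.inr (by linarith)).const_mul γ |>.mul hg))
    (fun y hy => Real.rpow_nonneg (hu0 y hy) _)
    (fun y hy => mul_nonneg (mul_nonneg (by linarith) (Real.rpow_nonneg (hu0 y hy) _)) (hg0 y hy))
    hq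
  have h2 : ∫⁻ x in cube ι, ENNReal.ofReal (u x ^ γ) ^ q = A := by
    refine setLIntegral_congr_fun measurableSet_cube fun x hx => ?_
    rw [← ENNReal.ofReal_rpow_of_nonneg (hu0 x hx) (by linarith), ← ENNReal.rpow_mul, hγq]
  have h3 : ∫⁻ x in cube ι, ENNReal.ofReal (u x ^ γ + γ * u x ^ (γ - 1) * g x) =
      ∫⁻ x in cube ι, ENNReal.ofReal (u x) ^ (γ - 1) * ENNReal.ofReal (u x + γ * g x) := by
    refine setLIntegral_congr_fun measurableSet_cube fun x hx => ?_
    rw [ENNReal.ofReal_rpow_of_nonneg (hu0 x hx) (by linarith),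
      ← ENNReal.ofReal_mul (Real.rpow_nonneg (hu0 x hx) _)]
    congr 1
    have : u x ^ γ = u x ^ (γ - 1) * u x := by
      conv_lhs => rw [show γ = (γ - 1) + 1 by ring]
      rw [Real.rpow_add_one' (hu0 x hx) (by linarith)]
    rw [this]; ring
  have h4 : ∫⁻ x in cube ι, (ENNReal.ofReal (u x) ^ (γ - 1)) ^ (2 : ℝ) ≤
      A ^ (2 * (γ - 1) / p) := by
    have := lintegral_rpow_le_rpow_lintegral hum (a := 2 * (γ - 1)) (by linarith) hγp
    refine le_trans (le_of_eq (lintegral_congr fun x => ?_)) this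
    rw [← ENNReal.rpow_mul, mul_comm]
  rw [h2, h3] at h1
  refine ENNReal.le_rpow_of_le_rpow_mul_rpow hAtop hγ ?_
  calc A ≤ _ := h1
    _ ≤ ((A ^ (2 * (γ - 1) / p)) ^ (1 / 2 : ℝ) * S ^ (1 / 2 : ℝ)) ^ q := by
        refine ENNReal.rpow_le_rpow ((lintegral_mul_le_sqrt (hum.pow_const _) hgm).trans ?_) hq0.le
        gcongr
    _ = A ^ ((γ - 1) / γ) * S ^ (p / 2 / γ) := by
        rw [ENNReal.mul_rpow_of_nonneg _ _ hq0.le, ← ENNReal.rpow_mul, ← ENNReal.rpow_mul,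
          ← ENNReal.rpow_mul, ← hγq]
        have hγ0 : γ ≠ 0 := by linarith
        congr 2 <;> field_simp

theorem lintegral_cube_rpow_le_of_unique [Unique ι]
    (hu : ∀ y ∈ cube ι, HasLipBoundAt u y (g y)) (hg : ContinuousOn g (cube ι))
    (hu0 : ∀ y ∈ cube ι, 0 ≤ u y) (hg0 : ∀ y ∈ cube ι, 0 ≤ g y) {p : ℝ} (hp : 0 < p) :
    ∫⁻ x in cube ι, ENNReal.ofReal (u x) ^ p ≤
      (∫⁻ x in cube ι, ENNReal.ofReal (u x + g x) ^ (2 : ℝ)) ^ (p / 2) := by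
  have huc : ContinuousOn u (cube ι) := continuousOn_of_hasLipBoundAt hu
  have hgm : AEMeasurable (fun x => ENNReal.ofReal (u x + g x)) (volume.restrict (cube ι)) :=
    ((huc.add hg).aemeasurable measurableSet_cube).ennreal_ofReal
  set S := ∫⁻ x in cube ι, ENNReal.ofReal (u x + g x) ^ (2 : ℝ) with hS
  have h : ∀ x ∈ cube ι, ENNReal.ofReal (u x) ^ p ≤ S ^ (p / 2) := by
    intro x hx
    have h1 := (ofReal_le_lintegral_cube_of_unique hu hg hu0 hg0 hx)
    have h2 := lintegral_rpow_le_rpow_lintegral hgm zero_le_one one_le_two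
    simp only [ENNReal.rpow_one] at h2
    have h3 := ENNReal.rpow_le_rpow (h1.trans h2) hp.le
    rwa [← ENNReal.rpow_mul, one_div_mul_eq_div] at h3
  calc _ ≤ ∫⁻ _ in cube ι, S ^ (p / 2) := setLIntegral_mono' measurableSet_cube h
    _ = _ := by simp

/-- The Sobolev inequality on the cube, without boundedness: truncation does not increase pointwise
Lipschitz constants. -/
theorem lintegral_cube_rpow_le_of_forall_bounded {p γ : ℝ} (hp : 0 < p)
    (hu : ∀ y ∈ cube ι, HasLipBoundAt u y (g y))
    (hu0 : ∀ y ∈ cube ι, 0 ≤ u y)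
    (h : ∀ w : (ι → ℝ) → ℝ, (∀ y ∈ cube ι, HasLipBoundAt w y (g y)) → (∀ y ∈ cube ι, 0 ≤ w y) →
      (∃ M, ∀ y ∈ cube ι, w y ≤ M) →
      ∫⁻ x in cube ι, ENNReal.ofReal (w x) ^ p ≤
        (∫⁻ x in cube ι, ENNReal.ofReal (w x + γ * g x) ^ (2 : ℝ)) ^ (p / 2)) :
    ∫⁻ x in cube ι, ENNReal.ofReal (u x) ^ p ≤
      (∫⁻ x in cube ι, ENNReal.ofReal (u x + γ * g x) ^ (2 : ℝ)) ^ (p / 2) := by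
  have huc : ContinuousOn u (cube ι) := continuousOn_of_hasLipBoundAt hu
  have hlim : Tendsto (fun k : ℕ => ∫⁻ x in cube ι, ENNReal.ofReal (min (u x) k) ^ p) atTop
      (𝓝 (∫⁻ x in cube ι, ENNReal.ofReal (u x) ^ p)) := by
    refine lintegral_tendsto_of_tendsto_of_monotone (fun k => ?_) ?_ ?_
    · have : ContinuousOn (fun x => min (u x) (k : ℝ)) (cube ι) := huc.inf continuousOn_const
      exact (this.aemeasurable measurableSet_cube).ennreal_ofReal.pow_const _
    · refine Eventually.of_forall fun x k l hkl => ?_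
      refine ENNReal.rpow_le_rpow (ENNReal.ofReal_le_ofReal ?_) hp.le
      exact min_le_min_left _ (by exact_mod_cast hkl)
    · refine Eventually.of_forall fun x => ?_
      refine tendsto_const_nhds.congr' ?_
      obtain ⟨k, hk⟩ := exists_nat_ge (u x)
      filter_upwards [eventually_ge_atTop k] with l hl
      rw [min_eq_left (hk.trans (by exact_mod_cast hl))]
  refine le_of_tendsto' hlim fun k => ?_
  have hLip : LipschitzWith 1 (fun t : ℝ => min t k) := by
    simpa using LipschitzWith.id.min_const (k : ℝ)
  refine (h (fun x => min (u x) k) (fun y hy => ?_) (fun y hy => le_min (hu0 y hy) k.cast_nonneg)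
    ⟨k, fun y _ => min_le_right _ _⟩).trans ?_
  · simpa [Function.comp_def] using (hLip.hasLipBoundAt (u y)).comp (hu y hy) zero_le_one
  · refine ENNReal.rpow_le_rpow ?_ (by positivity)
    refine setLIntegral_mono_ae' measurableSet_cube (Eventually.of_forall fun x hx => ?_)
    refine ENNReal.rpow_le_rpow (ENNReal.ofReal_le_ofReal ?_) zero_le_two
    gcongr
    exact min_le_left _ _

end Cube

/-- The Sobolev inequality on the cube of dimension `n`. -/
theorem exists_lintegral_cube_rpow_le {n : ℕ} {p : ℝ} (hp : IsSobolevExponent n p) :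
    0 < p ∧ ∃ γ : ℝ, 1 ≤ γ ∧ ∀ u g : (Fin n → ℝ) → ℝ,
      (∀ y ∈ cube (Fin n), HasLipBoundAt u y (g y)) → ContinuousOn g (cube (Fin n)) →
      (∀ y ∈ cube (Fin n), 0 ≤ u y) → (∀ y ∈ cube (Fin n), 0 ≤ g y) →
      ∫⁻ x in cube (Fin n), ENNReal.ofReal (u x) ^ p ≤
        (∫⁻ x in cube (Fin n), ENNReal.ofReal (u x + γ * g x) ^ (2 : ℝ)) ^ (p / 2) := by
  -- in dimension at least two, `γ` has to satisfy the assumptions of the bounded case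
  have main : ∀ q γ : ℝ, Real.HolderConjugate (n : ℝ) q → 1 ≤ γ → γ * q = p →
      2 * (γ - 1) ≤ p → 0 < p ∧ ∃ γ : ℝ, 1 ≤ γ ∧ ∀ u g : (Fin n → ℝ) → ℝ,
      (∀ y ∈ cube (Fin n), HasLipBoundAt u y (g y)) → ContinuousOn g (cube (Fin n)) →
      (∀ y ∈ cube (Fin n), 0 ≤ u y) → (∀ y ∈ cube (Fin n), 0 ≤ g y) →
      ∫⁻ x in cube (Fin n), ENNReal.ofReal (u x) ^ p ≤
        (∫⁻ x in cube (Fin n), ENNReal.ofReal (u x + γ * g x) ^ (2 : ℝ)) ^ (p / 2) := by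
    intro q γ hq hγ hγq hγp
    have hp0 : 0 < p := hγq ▸ mul_pos (by linarith) hq.symm.pos
    refine ⟨hp0, γ, hγ, fun u g hu hg hu0 hg0 => ?_⟩
    refine lintegral_cube_rpow_le_of_forall_bounded hp0 hu hu0 fun w hw hw0 ⟨M, hM⟩ => ?_
    exact lintegral_cube_rpow_le_of_bounded hw hg hw0 hg0 hM (by simpa using hq) hγ hγq hγp
  rcases hp with ⟨hn, hp⟩ | ⟨rfl | rfl, hp⟩
  · have hn' : (3 : ℝ) ≤ n := by exact_mod_cast hn
    have hn2 : (n : ℝ) - 2 ≠ 0 := by linarith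
    have hn1 : (n : ℝ) - 1 ≠ 0 := by linarith
    have hpe : p = 2 * n / (n - 2) := by
      rw [← one_div_one_div p, hp]; field_simp
    refine main (n / (n - 1)) (2 * (n - 1) / (n - 2))
      ((Real.holderConjugate_iff_eq_conjExponent (by linarith)).2 rfl) ?_ ?_ ?_
    · rw [le_div_iff₀ (by linarith)]; linarith
    · rw [hpe]; field_simp
    · rw [hpe]; apply le_of_eq; field_simp; ring
  · refine ⟨by linarith, 1, le_rfl, fun u g hu hg hu0 hg0 => ?_⟩
    simpa using lintegral_cube_rpow_le_of_unique hu hg hu0 hg0 (p := p) (by linarith)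
  · exact main 2 (p / 2) (by simpa using Real.HolderConjugate.two_two) (by linarith) (by ring)
      (by linarith)

/-! ### Bi-Lipschitz maps between convex bodies -/

/-- The radial map between two convex neighbourhoods of zero is Lipschitz: it is the multiplication
by the quotient of two Lipschitz functions, each comparable to the norm. -/
theorem exists_lipschitzWith_gaugeRescale {E : Type*} [NormedAddCommGroup E] [NormedSpace ℝ E]
    {s t : Set E} (hs : Convex ℝ s) (hs0 : s ∈ 𝓝 0) (ht : Convex ℝ t) (ht0 : t ∈ 𝓝 0)
    (htb : Bornology.IsBounded t) : ∃ K, LipschitzWith K (gaugeRescale s t) := by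
  obtain ⟨A, hA⟩ := hs.lipschitz_gauge hs0
  obtain ⟨B, hB⟩ := ht.lipschitz_gauge ht0
  obtain ⟨R, hR, htR⟩ := htb.subset_closedBall_lt 0 0
  have ha0 : ∀ x, gauge s x ≤ A * ‖x‖ := fun x => by
    have := hA.dist_le_mul x 0
    simp only [gauge_zero, dist_zero_right] at this
    exact (le_abs_self _).trans this
  have hb0 : ∀ x, ‖x‖ ≤ R * gauge t x := fun x => by
    have := le_gauge_of_subset_closedBall (absorbent_nhds_zero ht0) hR.le htR (x := x)
    rwa [div_le_iff₀' hR] at this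
  have hbpos : ∀ x, x ≠ 0 → 0 < gauge t x := fun x hx =>
    pos_of_mul_pos_right ((norm_pos_iff.2 hx).trans_le (hb0 x)) hR.le
  have hq : ∀ x, gauge s x / gauge t x ≤ A * R := by
    intro x
    rcases eq_or_ne x 0 with rfl | hx
    · simp only [gauge_zero, div_zero]; positivity
    · rw [div_le_iff₀ (hbpos x hx), mul_assoc]
      exact (ha0 x).trans (by gcongr; exact hb0 x)
  have hq0 : ∀ x, 0 ≤ gauge s x / gauge t x := fun x => div_nonneg (gauge_nonneg _) (gauge_nonneg _)
  have hF : ∀ x, ‖gaugeRescale s t x‖ ≤ A * R * ‖x‖ := by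
    intro x
    rw [gaugeRescale, norm_smul, Real.norm_of_nonneg (hq0 x)]
    gcongr
    exact hq x
  have hK : 0 ≤ A * R * (2 + B * R) := by positivity
  refine ⟨⟨A * R * (2 + B * R), hK⟩, LipschitzWith.of_dist_le_mul fun x y => ?_⟩
  change dist (gaugeRescale s t x) (gaugeRescale s t y) ≤ A * R * (2 + B * R) * dist x y
  rw [dist_eq_norm, dist_eq_norm]
  have hARK : A * R ≤ A * R * (2 + B * R) := by
    refine le_mul_of_one_le_right (by positivity) ?_
    have : 0 ≤ B * R := by positivity
    linarith
  rcases eq_or_ne x 0 with rfl | hx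
  · simp only [gaugeRescale_zero, zero_sub, norm_neg]
    exact (hF y).trans (by gcongr)
  rcases eq_or_ne y 0 with rfl | hy
  · simp only [gaugeRescale_zero, sub_zero]
    exact (hF x).trans (by gcongr)
  have hbx := hbpos x hx
  have hby := hbpos y hy
  have hAd : |gauge s x - gauge s y| ≤ A * ‖x - y‖ := by
    have := hA.dist_le_mul x y
    rwa [Real.dist_eq, dist_eq_norm] at this
  have hBd : |gauge t y - gauge t x| ≤ B * ‖x - y‖ := by
    have := hB.dist_le_mul y x
    rwa [Real.dist_eq, dist_eq_norm, norm_sub_rev] at this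
  have e1 : gauge s x / gauge t x - gauge s y / gauge t y =
      (gauge s x / gauge t x * (gauge t y - gauge t x) + (gauge s x - gauge s y)) / gauge t y := by
    field_simp
    ring
  have e2 : gaugeRescale s t x - gaugeRescale s t y =
      (gauge s x / gauge t x) • (x - y) +
        (gauge s x / gauge t x - gauge s y / gauge t y) • y := by
    rw [gaugeRescale, gaugeRescale, smul_sub, sub_smul]; abel
  have h2 : |gauge s x / gauge t x - gauge s y / gauge t y| * ‖y‖ ≤
      (A * R * B + A) * ‖x - y‖ * R := by
    rw [e1, abs_div, abs_of_pos hby, div_mul_eq_mul_div, div_le_iff₀ hby, mul_assoc _ R]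
    gcongr
    · refine (abs_add_le _ _).trans ?_
      rw [abs_mul, abs_of_nonneg (hq0 x), add_mul]
      refine add_le_add ?_ hAd
      rw [mul_assoc]
      gcongr
      exact hq x
    · exact hb0 y
  calc ‖gaugeRescale s t x - gaugeRescale s t y‖
      ≤ gauge s x / gauge t x * ‖x - y‖ +
        |gauge s x / gauge t x - gauge s y / gauge t y| * ‖y‖ := by
        rw [e2]
        refine (norm_add_le _ _).trans (le_of_eq ?_)
        rw [norm_smul, norm_smul, Real.norm_of_nonneg (hq0 x), Real.norm_eq_abs]
    _ ≤ A * R * ‖x - y‖ + (A * R * B + A) * ‖x - y‖ * R := by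
        gcongr
        exact hq x
    _ = A * R * (2 + B * R) * ‖x - y‖ := by ring

/-- A bounded convex open set is the image of the cube under a bi-Lipschitz homeomorphism of the
whole space. -/
theorem exists_biLipschitz_cube {n : ℕ} {Ω : Set (EuclideanSpace ℝ (Fin n))} (hΩ : IsOpen Ω)
    (hne : Ω.Nonempty) (hb : Bornology.IsBounded Ω) (hc : Convex ℝ Ω) :
    ∃ (Ψ : (Fin n → ℝ) ≃ₜ EuclideanSpace ℝ (Fin n)) (K L : NNReal),
      LipschitzWith K Ψ ∧ LipschitzWith L Ψ.symm ∧ Ψ ⁻¹' Ω = cube (Fin n) := by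
  obtain ⟨x₀, hx₀⟩ := hne
  let e : (Fin n → ℝ) ≃L[ℝ] EuclideanSpace ℝ (Fin n) := (EuclideanSpace.equiv (Fin n) ℝ).symm
  let a : (Fin n → ℝ) ≃ₜ EuclideanSpace ℝ (Fin n) := e.toHomeomorph.trans (Homeomorph.addLeft x₀)
  have ha : LipschitzWith _ a := (isometry_add_left x₀).lipschitz.comp e.lipschitz
  have ha' : LipschitzWith _ a.symm := e.symm.lipschitz.comp (isometry_add_left (-x₀)).lipschitz
  set t : Set (Fin n → ℝ) := a ⁻¹' Ω with ht
  have hto : IsOpen t := hΩ.preimage a.continuous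
  have ht0 : t ∈ 𝓝 0 := hto.mem_nhds (by simpa [ht, a] using hx₀)
  have htc : Convex ℝ t := (hc.translate_preimage_right x₀).linear_preimage e.toLinearMap
  have htb : Bornology.IsBounded t := by
    have := ha'.isBounded_image hb
    rwa [Homeomorph.image_symm] at this
  have hqc : Convex ℝ (cube (Fin n)) := convex_ball _ _
  have hq0 : cube (Fin n) ∈ 𝓝 0 := Metric.ball_mem_nhds _ (by norm_num)
  have hqb : Bornology.IsBounded (cube (Fin n)) := Metric.isBounded_ball
  let T := gaugeRescaleHomeomorph (cube (Fin n)) t hqc hq0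
    ((NormedSpace.isVonNBounded_iff ℝ).2 hqb) htc ht0 ((NormedSpace.isVonNBounded_iff ℝ).2 htb)
  obtain ⟨K, hK⟩ := exists_lipschitzWith_gaugeRescale hqc hq0 htc ht0 htb
  obtain ⟨L, hL⟩ := exists_lipschitzWith_gaugeRescale htc ht0 hqc hq0 hqb
  have hT : LipschitzWith K T := hK
  have hT' : LipschitzWith L T.symm := hL
  refine ⟨T.trans a, _, _, ha.comp hT, hT'.comp ha', ?_⟩
  have himg : T '' cube (Fin n) = t := by
    have := image_gaugeRescaleHomeomorph_interior hqc hq0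
      ((NormedSpace.isVonNBounded_iff ℝ).2 hqb) htc ht0 ((NormedSpace.isVonNBounded_iff ℝ).2 htb)
    rwa [isOpen_cube.interior_eq, hto.interior_eq] at this
  change T ⁻¹' t = cube (Fin n)
  rw [← himg, T.preimage_image]

theorem volume_image_le_of_lipschitzWith {n : ℕ} {f : (Fin n → ℝ) → (Fin n → ℝ)} {K : NNReal}
    (hf : LipschitzWith K f) (s : Set (Fin n → ℝ)) :
    volume (f '' s) ≤ (K : ENNReal) ^ n * volume s := by
  have := hf.hausdorffMeasure_image_le (d := n) (by positivity) s
  have hv : (μH[(n : ℝ)] : Measure (Fin n → ℝ)) = volume := by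
    simpa using hausdorffMeasure_pi_real (ι := Fin n)
  rwa [hv, ENNReal.rpow_natCast] at this

/-- Integrals over the image of the cube under a bi-Lipschitz map are comparable to integrals over
the cube. -/
theorem exists_lintegral_comp_cube_le {n : ℕ} {Ω : Set (EuclideanSpace ℝ (Fin n))}
    {Ψ : (Fin n → ℝ) ≃ₜ EuclideanSpace ℝ (Fin n)} {K L : NNReal} (hK : LipschitzWith K Ψ)
    (hL : LipschitzWith L Ψ.symm) (hΨ : Ψ ⁻¹' Ω = cube (Fin n)) :
    ∃ C : NNReal, ∀ F : EuclideanSpace ℝ (Fin n) → ENNReal,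
      ∫⁻ y in cube (Fin n), F (Ψ y) ≤ C * ∫⁻ x in Ω, F x ∧
      ∫⁻ x in Ω, F x ≤ C * ∫⁻ y in cube (Fin n), F (Ψ y) := by
  let m : (Fin n → ℝ) ≃ᵐ EuclideanSpace ℝ (Fin n) := MeasurableEquiv.toLp 2 (Fin n → ℝ)
  have hm : MeasurePreserving m volume volume := PiLp.volume_preserving_toLp (Fin n)
  let e : (Fin n → ℝ) ≃L[ℝ] EuclideanSpace ℝ (Fin n) := (EuclideanSpace.equiv (Fin n) ℝ).symm
  obtain ⟨K', hK'⟩ : ∃ K', LipschitzWith K' (m.symm ∘ Ψ) := ⟨_, e.symm.lipschitz.comp hK⟩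
  obtain ⟨L', hL'⟩ : ∃ L', LipschitzWith L' (Ψ.symm ∘ m) := ⟨_, hL.comp e.lipschitz⟩
  have h1 : Measure.map Ψ.symm volume ≤ ((K' ^ n : NNReal) : ENNReal) • volume := by
    refine Measure.le_iff.2 fun A hA => ?_
    rw [Measure.map_apply Ψ.symm.measurable hA, ← Ψ.image_eq_preimage_symm,
      ← hm.measure_preimage_equiv, ← m.image_symm, ← image_comp, Measure.smul_apply, smul_eq_mul,
      ENNReal.coe_pow]
    exact volume_image_le_of_lipschitzWith hK' A
  have h2 : Measure.map Ψ volume ≤ ((L' ^ n : NNReal) : ENNReal) • volume := by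
    refine Measure.le_iff.2 fun B hB => ?_
    rw [Measure.map_apply Ψ.measurable hB, Measure.smul_apply, smul_eq_mul, ENNReal.coe_pow,
      ← hm.measure_preimage_equiv B]
    refine le_trans (le_of_eq ?_) (volume_image_le_of_lipschitzWith hL' (m ⁻¹' B))
    rw [image_comp, m.image_preimage, Ψ.image_symm]
  refine ⟨K' ^ n + L' ^ n, fun F => ⟨?_, ?_⟩⟩
  · calc ∫⁻ y in cube (Fin n), F (Ψ y) = ∫⁻ x in Ω, F x ∂(Measure.map Ψ volume) := by
          rw [Ψ.measurableEmbedding.restrict_map, Ψ.measurableEmbedding.lintegral_map, hΨ]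
      _ ≤ ∫⁻ x in Ω, F x ∂(((L' ^ n : NNReal) : ENNReal) • volume) :=
          lintegral_mono' (Measure.restrict_mono_measure h2 _) le_rfl
      _ = ((L' ^ n : NNReal) : ENNReal) * ∫⁻ x in Ω, F x := by
          rw [Measure.restrict_smul, lintegral_smul_measure, smul_eq_mul]
      _ ≤ _ := by gcongr; exact le_add_self
  · have hΨ' : Ψ.symm ⁻¹' cube (Fin n) = Ω := by rw [← hΨ, ← preimage_comp]; simp
    calc ∫⁻ x in Ω, F x
        = ∫⁻ y in cube (Fin n), F (Ψ y) ∂(Measure.map Ψ.symm volume) := by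
          rw [Ψ.symm.measurableEmbedding.restrict_map, Ψ.symm.measurableEmbedding.lintegral_map,
            hΨ']
          simp
      _ ≤ ∫⁻ y in cube (Fin n), F (Ψ y) ∂(((K' ^ n : NNReal) : ENNReal) • volume) :=
          lintegral_mono' (Measure.restrict_mono_measure h1 _) le_rfl
      _ = ((K' ^ n : NNReal) : ENNReal) * ∫⁻ y in cube (Fin n), F (Ψ y) := by
          rw [Measure.restrict_smul, lintegral_smul_measure, smul_eq_mul]
      _ ≤ _ := by gcongr; exact le_self_add

/-! ### The Poincaré inequality on a convex domain -/

theorem _root_.MeasureTheory.lintegral_lintegral_const_mul_lintegral {α β γ : Type*}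
    [MeasurableSpace α] [MeasurableSpace β] [MeasurableSpace γ] {μ : Measure α} {ν : Measure β}
    {τ : Measure γ} [SFinite μ] [SFinite ν] [SFinite τ] {H : α → β → γ → ENNReal}
    (hH : Measurable fun q : (α × β) × γ => H q.1.1 q.1.2 q.2) (c : ENNReal) :
    ∫⁻ x, ∫⁻ y, c * ∫⁻ s, H x y s ∂τ ∂ν ∂μ = c * ∫⁻ s, ∫⁻ x, ∫⁻ y, H x y s ∂ν ∂μ ∂τ := by
  have h1 : ∀ x, Measurable fun y => ∫⁻ s, H x y s ∂τ := fun x =>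
    hH.lintegral_prod_right'.comp measurable_prodMk_left
  have h2 : Measurable fun q : α × γ => ∫⁻ y, H q.1 y q.2 ∂ν := by
    have : Measurable fun r : (α × γ) × β => H r.1.1 r.2 r.1.2 :=
      hH.comp ((measurable_fst.fst.prodMk measurable_snd).prodMk measurable_fst.snd)
    exact this.lintegral_prod_right'
  have h3 : ∀ x, ∫⁻ y, c * ∫⁻ s, H x y s ∂τ ∂ν = c * ∫⁻ s, ∫⁻ y, H x y s ∂ν ∂τ := by
    intro x
    rw [lintegral_const_mul c (h1 x), lintegral_lintegral_swap]
    exact (hH.comp ((measurable_const.prodMk measurable_fst).prodMk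
      measurable_snd)).aemeasurable
  simp_rw [h3]
  rw [lintegral_const_mul c h2.lintegral_prod_right', lintegral_lintegral_swap h2.aemeasurable]

section Poincare

variable {E F : Type*} [NormedAddCommGroup E] [NormedSpace ℝ E] [NormedAddCommGroup F]
  [NormedSpace ℝ F] {Ω : Set E} {v : E → F}

theorem hasLipBoundAt_of_contDiffOn (hΩ : IsOpen Ω) (hv : ContDiffOn ℝ 1 v Ω) {x : E}
    (hx : x ∈ Ω) : HasLipBoundAt v x ‖fderiv ℝ v x‖ :=
  ((hv.differentiableOn one_ne_zero).differentiableAt (hΩ.mem_nhds hx)).hasFDerivAt.hasLipBoundAt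

theorem enorm_sub_le_lintegral_lineMap (hΩ : IsOpen Ω) (hc : Convex ℝ Ω)
    (hv : ContDiffOn ℝ 1 v Ω) {x y : E} (hx : x ∈ Ω) (hy : y ∈ Ω) :
    ‖v y - v x‖ₑ ≤
      ‖y - x‖ₑ * ∫⁻ s in Icc (0 : ℝ) 1, ‖fderiv ℝ v (AffineMap.lineMap x y s)‖ₑ := by
  have hmem : ∀ s ∈ Icc (0 : ℝ) 1, AffineMap.lineMap x y s ∈ Ω := fun s hs =>
    hc.lineMap_mem hx hy hs
  have hcont : ContinuousOn (fderiv ℝ v) Ω := hv.continuousOn_fderiv_of_isOpen hΩ le_rfl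
  have hline : Continuous (fun s : ℝ => (AffineMap.lineMap x y s : E)) :=
    AffineMap.lineMap_continuous
  have h := ofReal_norm_sub_le_lintegral_of_hasLipBoundAt (zero_le_one (α := ℝ))
    (f := fun s => v (AffineMap.lineMap x y s))
    (g := fun s => ‖fderiv ℝ v (AffineMap.lineMap x y s)‖ * ‖y - x‖)
    (fun s hs => by
      have := (hasLipBoundAt_of_contDiffOn hΩ hv (hmem s hs)).comp
        ((lipschitzWith_lineMap x y).hasLipBoundAt s) (norm_nonneg _)
      rwa [coe_nndist, dist_comm, dist_eq_norm] at this)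
    ((hcont.comp hline.continuousOn hmem).norm.mul continuousOn_const)
    (fun s _ => by positivity)
  simp only [AffineMap.lineMap_apply_one, AffineMap.lineMap_apply_zero, ofReal_norm] at h
  refine h.trans (le_of_eq ?_)
  rw [← lintegral_const_mul' _ _ enorm_ne_top]
  refine lintegral_congr fun s => ?_
  rw [ENNReal.ofReal_mul (norm_nonneg _), ofReal_norm, ofReal_norm, mul_comm]

variable [MeasurableSpace E] [BorelSpace E] [FiniteDimensional ℝ E] (μ : Measure E)
  [μ.IsAddHaarMeasure]

/-- The homothety with center `x` and ratio at least `1/2` maps a convex set containing `x` into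
itself, with Jacobian bounded below. -/
theorem setLIntegral_lineMap_le (hΩ : MeasurableSet Ω) (hc : Convex ℝ Ω) {x : E} (hx : x ∈ Ω)
    {s : ℝ} (hs : s ∈ Icc (1 / 2 : ℝ) 1) (G : E → ENNReal) :
    ∫⁻ y in Ω, G (AffineMap.lineMap x y s) ∂μ ≤
      2 ^ Module.finrank ℝ E * ∫⁻ y in Ω, G y ∂μ := by
  have hs0 : 0 < s := by linarith [hs.1]
  have hmem : ∀ y ∈ Ω, AffineMap.lineMap x y s ∈ Ω := fun y hy =>
    hc.lineMap_mem hx hy ⟨hs0.le, hs.2⟩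
  calc ∫⁻ y in Ω, G (AffineMap.lineMap x y s) ∂μ
      ≤ ∫⁻ y, Ω.indicator G ((1 - s) • x + s • y) ∂μ := by
        rw [← lintegral_indicator hΩ]
        refine lintegral_mono fun y => ?_
        by_cases hy : y ∈ Ω
        · rw [indicator_of_mem hy, ← AffineMap.lineMap_apply_module,
            indicator_of_mem (hmem y hy)]
        · rw [indicator_of_notMem hy]; exact zero_le
    _ = ∫⁻ z, Ω.indicator G ((1 - s) • x + z) ∂(Measure.map (s • ·) μ) :=
        ((Homeomorph.smulOfNeZero s hs0.ne').measurableEmbedding.lintegral_map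
          (fun z => Ω.indicator G ((1 - s) • x + z))).symm
    _ = ENNReal.ofReal |(s ^ Module.finrank ℝ E)⁻¹| * ∫⁻ z in Ω, G z ∂μ := by
        rw [Measure.map_addHaar_smul μ hs0.ne', lintegral_smul_measure, smul_eq_mul,
          lintegral_add_left_eq_self, lintegral_indicator hΩ]
    _ ≤ _ := by
        gcongr
        rw [abs_of_pos (by positivity), ← inv_pow, ENNReal.ofReal_pow (by positivity)]
        gcongr
        rw [← ENNReal.ofReal_ofNat 2]
        refine ENNReal.ofReal_le_ofReal ?_
        rw [inv_le_comm₀ hs0 two_pos]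
        linarith [hs.1]

/-- The Poincaré inequality on a convex set, for the differences of the values at all pairs of
points: on each segment one of the two halves is swept out by homotheties of ratio at least `1/2`
about one of its endpoints. -/
theorem lintegral_lintegral_enorm_sub_sq_le [CompleteSpace F]
    (hΩ : IsOpen Ω) (hc : Convex ℝ Ω) (hv : ContDiffOn ℝ 1 v Ω) {d : ENNReal}
    (hd : ∀ x ∈ Ω, ∀ y ∈ Ω, ‖y - x‖ₑ ≤ d) :
    ∫⁻ x in Ω, ∫⁻ y in Ω, ‖v y - v x‖ₑ ^ (2 : ℝ) ∂μ ∂μ ≤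
      d ^ (2 : ℝ) * (2 ^ Module.finrank ℝ E * μ Ω * ∫⁻ x in Ω, ‖fderiv ℝ v x‖ₑ ^ (2 : ℝ) ∂μ) := by
  have hΩm := hΩ.measurableSet
  set G : E → ENNReal := fun x => ‖fderiv ℝ v x‖ₑ ^ (2 : ℝ) with hG
  have hfd : Measurable (fun x => ‖fderiv ℝ v x‖ₑ) := (measurable_fderiv ℝ v).enorm
  have hGm : Measurable G := hfd.pow_const _
  set I := ∫⁻ x in Ω, G x ∂μ with hI
  have hline : Measurable (fun q : (E × E) × ℝ => G (AffineMap.lineMap q.1.1 q.1.2 q.2)) := by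
    refine hGm.comp (Continuous.measurable ?_)
    simp only [AffineMap.lineMap_apply_module]
    fun_prop
  have hpt : ∀ x ∈ Ω, ∀ y ∈ Ω, ‖v y - v x‖ₑ ^ (2 : ℝ) ≤
      d ^ (2 : ℝ) * ∫⁻ s in Icc (0 : ℝ) 1, G (AffineMap.lineMap x y s) := by
    intro x hx y hy
    have hm : Measurable (fun s : ℝ => ‖fderiv ℝ v (AffineMap.lineMap x y s)‖ₑ) :=
      hfd.comp (AffineMap.lineMap_continuous (R := ℝ) (p := x) (q := y)).measurable
    have h1 := lintegral_mul_le_sqrt (μ := volume.restrict (Icc (0 : ℝ) 1)) hm.aemeasurable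
      (aemeasurable_const (b := (1 : ENNReal)))
    simp only [mul_one, ENNReal.one_rpow, lintegral_const, Measure.restrict_apply_univ,
      Real.volume_Icc, sub_zero, ENNReal.ofReal_one] at h1
    have h2 := (enorm_sub_le_lintegral_lineMap hΩ hc hv hx hy).trans
      (mul_le_mul' (hd x hx y hy) h1)
    have h3 := ENNReal.rpow_le_rpow h2 zero_le_two
    rwa [ENNReal.mul_rpow_of_nonneg _ _ zero_le_two, ← ENNReal.rpow_mul,
      one_div_mul_cancel two_ne_zero, ENNReal.rpow_one] at h3
  have hs : ∀ s ∈ Icc (0 : ℝ) 1,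
      ∫⁻ x in Ω, ∫⁻ y in Ω, G (AffineMap.lineMap x y s) ∂μ ∂μ ≤
        2 ^ Module.finrank ℝ E * μ Ω * I := by
    intro s hs
    have hconst : ∀ H : E → ENNReal, (∀ x ∈ Ω, H x ≤ 2 ^ Module.finrank ℝ E * I) →
        ∫⁻ x in Ω, H x ∂μ ≤ 2 ^ Module.finrank ℝ E * μ Ω * I := by
      intro H hH
      refine (setLIntegral_mono' hΩm hH).trans (le_of_eq ?_)
      rw [setLIntegral_const]; ring
    rcases le_total (1 / 2) s with h | h
    · exact hconst _ fun x hx => setLIntegral_lineMap_le μ hΩm hc hx ⟨h, hs.2⟩ G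
    · -- exchanging `x` and `y` replaces `s` by `1 - s`
      rw [lintegral_lintegral_swap]
      · refine hconst _ fun y hy => ?_
        have := setLIntegral_lineMap_le μ hΩm hc hy (s := 1 - s)
          ⟨by linarith, by linarith [hs.1]⟩ G
        simpa only [AffineMap.lineMap_apply_one_sub] using this
      · exact (hline.comp (measurable_id.prodMk measurable_const)).aemeasurable
  calc ∫⁻ x in Ω, ∫⁻ y in Ω, ‖v y - v x‖ₑ ^ (2 : ℝ) ∂μ ∂μ
      ≤ ∫⁻ x in Ω, ∫⁻ y in Ω, d ^ (2 : ℝ) *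
          (∫⁻ s in Icc (0 : ℝ) 1, G (AffineMap.lineMap x y s)) ∂μ ∂μ :=
        setLIntegral_mono' hΩm fun x hx => setLIntegral_mono' hΩm fun y hy => hpt x hx y hy
    _ = d ^ (2 : ℝ) * ∫⁻ s in Icc (0 : ℝ) 1, ∫⁻ x in Ω, ∫⁻ y in Ω,
          G (AffineMap.lineMap x y s) ∂μ ∂μ :=
        lintegral_lintegral_const_mul_lintegral hline _
    _ ≤ d ^ (2 : ℝ) * (2 ^ Module.finrank ℝ E * μ Ω * I) := by
        gcongr
        refine (setLIntegral_mono' measurableSet_Icc hs).trans (le_of_eq ?_)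
        simp

end Poincare

section Average

variable {E F : Type*} [MeasurableSpace E] [NormedAddCommGroup F]
  {μ : Measure E} {Ω : Set E} {v : E → F}

theorem enorm_sub_setAverage_sq_le [NormedSpace ℝ F] [CompleteSpace F] (h0 : μ Ω ≠ 0)
    (hfin : μ Ω ≠ ⊤) (hv : IntegrableOn v Ω μ) (x : E) :
    ‖v x - ⨍ y in Ω, v y ∂μ‖ₑ ^ (2 : ℝ) ≤
      (μ Ω)⁻¹ * ∫⁻ y in Ω, ‖v y - v x‖ₑ ^ (2 : ℝ) ∂μ := by
  have : NeZero (μ.restrict Ω) := ⟨by simpa using h0⟩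
  have : IsFiniteMeasure (μ.restrict Ω) := ⟨by simpa using hfin.lt_top⟩
  set m : Measure E := (μ.restrict Ω univ)⁻¹ • μ.restrict Ω with hm
  have : IsProbabilityMeasure m := isProbabilityMeasureSMul
  have hvm : Integrable v m := hv.smul_measure (by simpa using h0)
  have h1 : ∫ y, (v x - v y) ∂m = v x - ⨍ y in Ω, v y ∂μ := by
    rw [integral_sub (integrable_const _) hvm, integral_const, probReal_univ, one_smul,
      average_eq']
  calc ‖v x - ⨍ y in Ω, v y ∂μ‖ₑ ^ (2 : ℝ)
      ≤ (∫⁻ y, ‖v x - v y‖ₑ ∂m) ^ (2 : ℝ) := by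
        rw [← h1]
        exact ENNReal.rpow_le_rpow (enorm_integral_le_lintegral_enorm _) zero_le_two
    _ ≤ ∫⁻ y, ‖v x - v y‖ₑ ^ (2 : ℝ) ∂m := by
        have hae : AEMeasurable (fun y => ‖v x - v y‖ₑ) m :=
          (aestronglyMeasurable_const.sub hvm.aestronglyMeasurable).enorm
        have := ENNReal.rpow_le_rpow
          (lintegral_rpow_le_rpow_lintegral hae zero_le_one one_le_two) zero_le_two
        rw [← ENNReal.rpow_mul, one_div_mul_cancel two_ne_zero] at this
        simpa only [ENNReal.rpow_one] using this
    _ = _ := by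
        rw [hm, lintegral_smul_measure, smul_eq_mul, Measure.restrict_apply_univ]
        simp_rw [← enorm_sub_rev (v x)]

/-- If the differences are square integrable over all pairs of points, then so is `v y - v x` in `y`
for some fixed `x`. -/
theorem integrableOn_of_lintegral_lintegral_enorm_sub_sq_lt_top
    (h0 : μ Ω ≠ 0) (hfin : μ Ω ≠ ⊤) (hv : AEStronglyMeasurable v (μ.restrict Ω))
    (h : ∫⁻ x in Ω, ∫⁻ y in Ω, ‖v y - v x‖ₑ ^ (2 : ℝ) ∂μ ∂μ < ⊤) : IntegrableOn v Ω μ := by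
  have : IsFiniteMeasure (μ.restrict Ω) := ⟨by simpa using hfin.lt_top⟩
  obtain ⟨x, hx⟩ : ∃ x, ∫⁻ y in Ω, ‖v y - v x‖ₑ ^ (2 : ℝ) ∂μ < ⊤ := by
    by_contra! hcon
    refine h.ne (top_le_iff.1 ?_)
    calc (⊤ : ENNReal) = ∫⁻ _ in Ω, ⊤ ∂μ := by simp [h0]
      _ ≤ _ := lintegral_mono fun x => hcon x
  have hL2 : MemLp (fun y => v y - v x) 2 (μ.restrict Ω) := by
    refine ⟨hv.sub aestronglyMeasurable_const, ?_⟩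
    rw [eLpNorm_lt_top_iff_lintegral_rpow_enorm_lt_top two_ne_zero ENNReal.ofNat_ne_top]
    simpa using hx
  have := (hL2.integrable one_le_two).add (integrable_const (v x))
  exact this.congr (Eventually.of_forall fun y => by simp)

end Average

/-! ### The Sobolev-Poincaré inequality on a convex domain -/

/-- The Sobolev-Poincaré inequality, without weight, on a bounded convex open set. -/
theorem exists_lintegral_enorm_sub_setAverage_rpow_le {n : ℕ}
    {Ω : Set (EuclideanSpace ℝ (Fin n))} (hΩ : IsOpen Ω)
    (hne : Ω.Nonempty) (hb : Bornology.IsBounded Ω) (hc : Convex ℝ Ω) {p : ℝ}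
    (hp : IsSobolevExponent n p) {F : Type*} [NormedAddCommGroup F] [NormedSpace ℝ F]
    [CompleteSpace F] :
    ∃ C : ENNReal, C ≠ ⊤ ∧ ∀ v : EuclideanSpace ℝ (Fin n) → F, ContDiffOn ℝ 1 v Ω →
      ∫⁻ x in Ω, ‖fderiv ℝ v x‖ₑ ^ (2 : ℝ) < ⊤ → IntegrableOn v Ω ∧
        ∫⁻ x in Ω, ‖v x - ⨍ y in Ω, v y‖ₑ ^ p ≤
          C * (∫⁻ x in Ω, ‖fderiv ℝ v x‖ₑ ^ (2 : ℝ)) ^ (p / 2) := by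
  obtain ⟨hp0, γ, hγ, hS⟩ := exists_lintegral_cube_rpow_le hp
  obtain ⟨Ψ, K, L, hK, hL, hΨ⟩ := exists_biLipschitz_cube hΩ hne hb hc
  obtain ⟨C₀, hC₀⟩ := exists_lintegral_comp_cube_le hK hL hΨ
  have hΩm := hΩ.measurableSet
  have h0 : volume Ω ≠ 0 := (hΩ.measure_pos volume hne).ne'
  have hfin : volume Ω ≠ ⊤ := hb.measure_lt_top.ne
  -- a bound for the diameter
  obtain ⟨d, hd⟩ : ∃ d : NNReal, ∀ x ∈ Ω, ∀ y ∈ Ω, ‖y - x‖ₑ ≤ d := by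
    obtain ⟨d, hd⟩ := Metric.isBounded_iff.1 hb
    refine ⟨d.toNNReal, fun x hx y hy => ?_⟩
    rw [← ofReal_norm, ← dist_eq_norm]
    exact ENNReal.ofReal_le_ofReal (hd hy hx)
  set C₁ : ENNReal := (d : ENNReal) ^ (2 : ℝ) * (2 ^ n * volume Ω) with hC₁
  have hC₁t : C₁ ≠ ⊤ := by
    refine ENNReal.mul_ne_top (by simp) (ENNReal.mul_ne_top (by simp) hfin)
  set C₂ : ENNReal := (volume Ω)⁻¹ * C₁ with hC₂
  have hC₂t : C₂ ≠ ⊤ := ENNReal.mul_ne_top (by simpa using h0) hC₁t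
  set A : ENNReal := ENNReal.ofReal (γ * K) with hA
  refine ⟨C₀ * (2 * (C₀ * (C₂ + A ^ (2 : ℝ)))) ^ (p / 2), ?_, fun v hv hfinite => ?_⟩
  · refine ENNReal.mul_ne_top (by simp) (ENNReal.rpow_ne_top_of_nonneg (by positivity) ?_)
    refine ENNReal.mul_ne_top (by simp) (ENNReal.mul_ne_top (by simp) ?_)
    exact ENNReal.add_ne_top.2 ⟨hC₂t, by simp [hA]⟩
  set D := ∫⁻ x in Ω, ‖fderiv ℝ v x‖ₑ ^ (2 : ℝ) with hD
  have hP : ∫⁻ x in Ω, ∫⁻ y in Ω, ‖v y - v x‖ₑ ^ (2 : ℝ) ≤ C₁ * D := by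
    refine (lintegral_lintegral_enorm_sub_sq_le volume hΩ hc hv hd).trans (le_of_eq ?_)
    rw [finrank_euclideanSpace_fin, hC₁, mul_assoc, mul_assoc, mul_assoc]
  have hvi : IntegrableOn v Ω :=
    integrableOn_of_lintegral_lintegral_enorm_sub_sq_lt_top h0 hfin
      (hv.continuousOn.aestronglyMeasurable hΩm)
      (hP.trans_lt (ENNReal.mul_lt_top hC₁t.lt_top hfinite))
  refine ⟨hvi, ?_⟩
  set a := ⨍ y in Ω, v y with ha
  have hL2 : ∫⁻ x in Ω, ‖v x - a‖ₑ ^ (2 : ℝ) ≤ C₂ * D := by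
    calc ∫⁻ x in Ω, ‖v x - a‖ₑ ^ (2 : ℝ)
        ≤ ∫⁻ x in Ω, (volume Ω)⁻¹ * ∫⁻ y in Ω, ‖v y - v x‖ₑ ^ (2 : ℝ) :=
          lintegral_mono fun x => enorm_sub_setAverage_sq_le h0 hfin hvi x
      _ = (volume Ω)⁻¹ * ∫⁻ x in Ω, ∫⁻ y in Ω, ‖v y - v x‖ₑ ^ (2 : ℝ) :=
          lintegral_const_mul' _ _ (by simpa using h0)
      _ ≤ (volume Ω)⁻¹ * (C₁ * D) := by gcongr
      _ = C₂ * D := (mul_assoc _ _ _).symm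
  have hmem : ∀ y ∈ cube (Fin n), Ψ y ∈ Ω := fun y hy => by rwa [← hΨ] at hy
  -- the Sobolev inequality for the pullback to the cube
  have hQ := hS (fun y => ‖v (Ψ y) - a‖) (fun y => ‖fderiv ℝ v (Ψ y)‖ * K)
    (fun y hy => by
      have hn : LipschitzWith 1 (fun z : F => ‖z - a‖) := by
        simpa [Function.comp_def] using lipschitzWith_one_norm.comp (LipschitzWith.id.sub (LipschitzWith.const a))
      have h1 := (hn.hasLipBoundAt (v (Ψ y))).comp
        (hasLipBoundAt_of_contDiffOn hΩ hv (hmem y hy)) zero_le_one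
      have h2 := h1.comp (hK.hasLipBoundAt y) (by positivity)
      simpa [Function.comp_def] using h2)
    (((hv.continuousOn_fderiv_of_isOpen hΩ le_rfl).comp Ψ.continuous.continuousOn hmem).norm.mul
      continuousOn_const)
    (fun y _ => norm_nonneg _) (fun y _ => by positivity)
  have hfd : Measurable (fun x => ‖fderiv ℝ v x‖ₑ ^ (2 : ℝ)) :=
    (measurable_fderiv ℝ v).enorm.pow_const _
  have hR : ∫⁻ y in cube (Fin n),
      ENNReal.ofReal (‖v (Ψ y) - a‖ + γ * (‖fderiv ℝ v (Ψ y)‖ * K)) ^ (2 : ℝ) ≤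
        2 * (C₀ * (C₂ + A ^ (2 : ℝ))) * D := by
    calc _ ≤ ∫⁻ y in cube (Fin n), 2 * (‖v (Ψ y) - a‖ₑ ^ (2 : ℝ) +
          A ^ (2 : ℝ) * ‖fderiv ℝ v (Ψ y)‖ₑ ^ (2 : ℝ)) := by
          refine lintegral_mono fun y => ?_
          have e : ENNReal.ofReal (‖v (Ψ y) - a‖ + γ * (‖fderiv ℝ v (Ψ y)‖ * K)) =
              ‖v (Ψ y) - a‖ₑ + A * ‖fderiv ℝ v (Ψ y)‖ₑ := by
            rw [ENNReal.ofReal_add (norm_nonneg _) (by positivity), ofReal_norm, hA,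
              ← ofReal_norm (fderiv ℝ v (Ψ y)), ← ENNReal.ofReal_mul (by positivity)]
            congr 2; ring
          rw [e, ← ENNReal.mul_rpow_of_nonneg _ _ zero_le_two]
          refine (ENNReal.rpow_add_le_mul_rpow_add_rpow _ _ one_le_two).trans (le_of_eq ?_)
          norm_num
      _ = 2 * (∫⁻ y in cube (Fin n), ‖v (Ψ y) - a‖ₑ ^ (2 : ℝ)) +
          2 * (A ^ (2 : ℝ) * ∫⁻ y in cube (Fin n), ‖fderiv ℝ v (Ψ y)‖ₑ ^ (2 : ℝ)) := by
          rw [lintegral_const_mul' _ _ (by simp), lintegral_add_right,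
            lintegral_const_mul' _ _ (by simp [hA]), mul_add]
          exact (hfd.comp Ψ.measurable).const_mul _
      _ ≤ 2 * (C₀ * (C₂ * D)) + 2 * (A ^ (2 : ℝ) * (C₀ * D)) := by
          gcongr
          · exact (hC₀ fun x => ‖v x - a‖ₑ ^ (2 : ℝ)).1.trans (by gcongr)
          · exact (hC₀ fun x => ‖fderiv ℝ v x‖ₑ ^ (2 : ℝ)).1
      _ = _ := by ring
  calc ∫⁻ x in Ω, ‖v x - a‖ₑ ^ p ≤ C₀ * ∫⁻ y in cube (Fin n), ‖v (Ψ y) - a‖ₑ ^ p :=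
        (hC₀ fun x => ‖v x - a‖ₑ ^ p).2
    _ ≤ C₀ * (2 * (C₀ * (C₂ + A ^ (2 : ℝ))) * D) ^ (p / 2) := by
        gcongr
        simp only [ofReal_norm] at hQ
        exact hQ.trans (ENNReal.rpow_le_rpow hR (by positivity))
    _ = _ := by rw [ENNReal.mul_rpow_of_nonneg _ _ (by positivity), mul_assoc]

/-! ### The weighted inequality -/

/-- The operator norm is at most the Frobenius norm. -/
theorem norm_fderiv_sq_le_gradNormSq {n : ℕ}
    (v : EuclideanSpace ℝ (Fin n) → EuclideanSpace ℝ (Fin n)) (x : EuclideanSpace ℝ (Fin n)) :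
    ‖fderiv ℝ v x‖ ^ 2 ≤ gradNormSq v x := by
  set T := fderiv ℝ v x with hT
  have hg : gradNormSq v x = ∑ i, ‖T (EuclideanSpace.single i 1)‖ ^ 2 := by
    refine Finset.sum_congr rfl fun i _ => ?_
    rw [EuclideanSpace.norm_sq_eq]
    simp [hT]
  rw [hg]
  refine (Real.le_sqrt (norm_nonneg _) (by positivity)).1 ?_
  refine T.opNorm_le_bound (Real.sqrt_nonneg _) fun y => ?_
  have hy : y = ∑ i, y i • EuclideanSpace.single i (1 : ℝ) := by
    simpa using ((EuclideanSpace.basisFun (Fin n) ℝ).sum_repr y).symm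
  calc ‖T y‖ = ‖∑ i, y i • T (EuclideanSpace.single i 1)‖ := by
        conv_lhs => rw [hy]
        simp only [map_sum, map_smul]
    _ ≤ ∑ i, ‖T (EuclideanSpace.single i 1)‖ * ‖y i‖ := by
        refine (norm_sum_le _ _).trans (le_of_eq (Finset.sum_congr rfl fun i _ => ?_))
        rw [norm_smul, mul_comm]
    _ ≤ _ := by
        rw [EuclideanSpace.norm_eq]
        exact Real.sum_mul_le_sqrt_mul_sqrt _ _ _

/-- Bounds for a solution at positive times extend to the initial time by continuity. -/
theorem IsClassicalSolution.bounds {n : ℕ} {Ω : Set (EuclideanSpace ℝ (Fin n))} {α : ℝ}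
    {d φ ρ₀ : EuclideanSpace ℝ (Fin n) → ℝ} {ρ : EuclideanSpace ℝ (Fin n) → ℝ → ℝ}
    (hρ : IsClassicalSolution Ω α d φ ρ₀ ρ) {c₁ c₂ : ℝ}
    (h : ∀ x ∈ closure Ω, ∀ t : ℝ, 0 < t → c₁ ≤ ρ x t ∧ ρ x t ≤ c₂)
    {x : EuclideanSpace ℝ (Fin n)} (hx : x ∈ closure Ω) {t : ℝ} (ht : 0 ≤ t) :
    c₁ ≤ ρ x t ∧ ρ x t ≤ c₂ := by
  rcases ht.eq_or_lt with rfl | ht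
  swap
  · exact h x hx t ht
  have hc : ContinuousOn (fun s => ρ x s) (Ici 0) :=
    hρ.continuousOn.comp (f := fun s : ℝ => (x, s)) (by fun_prop) fun s hs => ⟨hx, hs⟩
  have hlim : Tendsto (fun s => ρ x s) (𝓝[>] 0) (𝓝 (ρ x 0)) :=
    (hc 0 self_mem_Ici).mono_left (nhdsWithin_mono _ Ioi_subset_Ici_self)
  have hev : ∀ᶠ s in 𝓝[>] (0 : ℝ), c₁ ≤ ρ x s ∧ ρ x s ≤ c₂ := by
    filter_upwards [self_mem_nhdsWithin] with s hs using h x hx s hs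
  exact ⟨ge_of_tendsto hlim (hev.mono fun _ h => h.1), le_of_tendsto hlim (hev.mono fun _ h => h.2)⟩

end NFP

theorem mainTheorem4 (n : ℕ) (Ω : Set (EuclideanSpace ℝ (Fin n)))
    (hΩ : NFP.IsSmoothConvexDomain Ω) (p : ℝ) (hp : NFP.IsSobolevExponent n p)
    (c₁ c₂ : ℝ) (hc₁ : 0 < c₁) (hc₂ : 0 < c₂) :
    ∃ C : ℝ, 0 < C ∧
      ∀ (α : ℝ) (d φ ρ₀ : EuclideanSpace ℝ (Fin n) → ℝ) (ρ : EuclideanSpace ℝ (Fin n) → ℝ → ℝ),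
        NFP.IsData Ω α d φ ρ₀ →
        NFP.IsClassicalSolution Ω α d φ ρ₀ ρ →
        (∀ x ∈ closure Ω, ∀ t : ℝ, 0 < t → c₁ ≤ ρ x t ∧ ρ x t ≤ c₂) →
        ∀ t : ℝ, 0 ≤ t →
        ∀ v : EuclideanSpace ℝ (Fin n) → EuclideanSpace ℝ (Fin n), ContDiffOn ℝ 1 v Ω →
          ((∫⁻ x in Ω, ENNReal.ofReal (NFP.gradNormSq v x * ρ x t)) < ⊤ → IntegrableOn v Ω) ∧
          (∫⁻ x in Ω, ENNReal.ofReal (‖v x - ⨍ y in Ω, v y‖ ^ p * ρ x t)) ^ (1 / p) ≤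
            ENNReal.ofReal C *
              (∫⁻ x in Ω, ENNReal.ofReal (NFP.gradNormSq v x * ρ x t)) ^ (1 / 2 : ℝ) := by
  obtain ⟨B, hB, hmain⟩ := NFP.exists_lintegral_enorm_sub_setAverage_rpow_le hΩ.isOpen hΩ.nonempty
    hΩ.isBounded hΩ.convex hp (F := EuclideanSpace ℝ (Fin n))
  have hp0 : 0 < p := (NFP.exists_lintegral_cube_rpow_le hp).1
  have hΩm := hΩ.isOpen.measurableSet
  set A : ENNReal := (ENNReal.ofReal c₂ * B) ^ (1 / p) * ENNReal.ofReal c₁⁻¹ ^ (1 / 2 : ℝ) with hA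
  have hAt : A ≠ ⊤ := by
    refine ENNReal.mul_ne_top (ENNReal.rpow_ne_top_of_nonneg (by positivity) ?_)
      (ENNReal.rpow_ne_top_of_nonneg (by positivity) ENNReal.ofReal_ne_top)
    exact ENNReal.mul_ne_top ENNReal.ofReal_ne_top hB
  refine ⟨A.toReal + 1, by positivity, fun α d φ ρ₀ ρ _ hρ hbd t ht v hv => ?_⟩
  have hAC : A ≤ ENNReal.ofReal (A.toReal + 1) := by
    rw [← ENNReal.ofReal_toReal hAt]
    exact ENNReal.ofReal_le_ofReal (by simp)
  have hρb : ∀ x ∈ Ω, c₁ ≤ ρ x t ∧ ρ x t ≤ c₂ := fun x hx => hρ.bounds hbd (subset_closure hx) ht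
  set R := ∫⁻ x in Ω, ENNReal.ofReal (NFP.gradNormSq v x * ρ x t) with hR
  set D := ∫⁻ x in Ω, ‖fderiv ℝ v x‖ₑ ^ (2 : ℝ) with hD
  have hDR : D ≤ ENNReal.ofReal c₁⁻¹ * R := by
    rw [hR, ← lintegral_const_mul' _ _ ENNReal.ofReal_ne_top]
    refine setLIntegral_mono' hΩm fun x hx => ?_
    rw [← ENNReal.ofReal_mul (by positivity), ← ofReal_norm, ENNReal.rpow_ofNat,
      ← ENNReal.ofReal_pow (norm_nonneg _)]
    refine ENNReal.ofReal_le_ofReal ((NFP.norm_fderiv_sq_le_gradNormSq v x).trans ?_)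
    rw [le_inv_mul_iff₀' hc₁]
    exact mul_le_mul_of_nonneg_left (hρb x hx).1
      ((sq_nonneg _).trans (NFP.norm_fderiv_sq_le_gradNormSq v x))
  have hDt : R < ⊤ → D < ⊤ := fun h =>
    hDR.trans_lt (ENNReal.mul_lt_top ENNReal.ofReal_lt_top h)
  refine ⟨fun h => (hmain v hv (hDt h)).1, ?_⟩
  rcases eq_or_ne R ⊤ with hRt | hRt
  · -- the inequality is trivial, the constant being positive
    rw [hRt, ENNReal.top_rpow_of_pos (by norm_num), ENNReal.mul_top]
    · exact le_top
    · simp; positivity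
  have key := (hmain v hv (hDt (lt_top_iff_ne_top.2 hRt))).2
  have hleft : ∫⁻ x in Ω, ENNReal.ofReal (‖v x - ⨍ y in Ω, v y‖ ^ p * ρ x t) ≤
      ENNReal.ofReal c₂ * ∫⁻ x in Ω, ‖v x - ⨍ y in Ω, v y‖ₑ ^ p := by
    rw [← lintegral_const_mul' _ _ ENNReal.ofReal_ne_top]
    refine setLIntegral_mono' hΩm fun x hx => ?_
    rw [← ofReal_norm, ENNReal.ofReal_rpow_of_nonneg (norm_nonneg _) hp0.le,
      ← ENNReal.ofReal_mul hc₂.le, mul_comm c₂]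
    refine ENNReal.ofReal_le_ofReal ?_
    gcongr
    exact (hρb x hx).2
  calc (∫⁻ x in Ω, ENNReal.ofReal (‖v x - ⨍ y in Ω, v y‖ ^ p * ρ x t)) ^ (1 / p)
      ≤ (ENNReal.ofReal c₂ * B * (ENNReal.ofReal c₁⁻¹ * R) ^ (p / 2)) ^ (1 / p) := by
        refine ENNReal.rpow_le_rpow (hleft.trans ?_) (by positivity)
        rw [mul_assoc]
        gcongr
        exact key.trans (by gcongr)
    _ = A * R ^ (1 / 2 : ℝ) := by
        have hpe : p / 2 * (1 / p) = 1 / 2 := by field_simp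
        rw [ENNReal.mul_rpow_of_nonneg (ENNReal.ofReal c₂ * B) _ (by positivity),
          ← ENNReal.rpow_mul, hpe,
          ENNReal.mul_rpow_of_nonneg (ENNReal.ofReal c₁⁻¹) _ (by norm_num), ← mul_assoc]
    _ ≤ _ := by gcongr
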